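/- For a sequence $(x_n)_{n\ge 1}$ in $[0,1)$ and $N\ge 1$ let $x_1^*\le\dots\le x_N^*$ be $x_1,\dots,x_N$ ordered by size. The gaps of $x_1,\dots,x_N$ are the $N$ numbers $x_{j+1}^*-x_j^*$ ($1\le j<N$) and $1+x_1^*-x_N^*$; let $L_1<\dots<L_K$ be the distinct gap lengths, $N_k$ the multiplicity of $L_k$ among the $N$ gaps, and $n_k(j)$ the number of gaps of length $L_k$ between $x_1^*$ and $x_j^*$. Let $D_N^*=\sup_{0\le b\le 1}\left|\frac1N\#\{1\le n\le N: x_n\in[0,b)\}-b\right|$ be the star-discrepancy; the sequence is a low-discrepancy sequence if $D_N^*=O(N^{-1}\log N)$. **Statement.** For every $R\in\mathbb N$ there is a constant $C>0$ such that the following holds for every irrational $z=[a_0;a_1,a_2,\dots]$ whose partial quotients satisfy $a_i\le R$ for all $i\ge1$. Consider the Kronecker sequence $x_n=\{nz\}$, $n\ge1$. 1. For every $N\ge 1$ the points $x_1,\dots,x_N$ have at most three different gap lengths. 2. For every $N\ge2$ the largest gap length is $L_K=\frac{\rho+2}{N}$ for some $\rho=\rho(N)$ with $-1<\rho\le C$,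 and for all $j=1,\dots,N$ $$x_j^*=x_1^*+\sum_{k=1}^K n_k(j)L_k,\qquad n_k(j)\in\left[\tfrac{N_k}{N}j-\varepsilon,\ \tfrac{N_k}{N}j+\varepsilon\right]\quad(k=1,\dots,K),\qquad \varepsilon=C\log N.$$ 3. $(\{nz\})_{n\ge1}$ is a low-discrepancy sequence. -/

import Mathlib

open Finset

/-- The Kronecker sequence `({n z})` of `z`; its terms are used for `n = 1, 2, 3, …`. -/
noncomputable def kronecker (z : ℝ) (n : ℕ) : ℝ := Int.fract ((n : ℝ) * z)

/-- The partial quotients `a₁, a₂, …` of the (regular) continued fraction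
`z = [a₀; a₁, a₂, …]` are all at most `R`. -/
def PartialQuotientsLE (z : ℝ) (R : ℕ) : Prop :=
  ∀ (i : ℕ) (a : ℝ), (GenContFract.of z).partDens.get? i = some a → a ≤ R

/-- The first `N` elements `x₁, …, x_N` of a sequence, ordered by size; the value at
`i : Fin N` is the `(i + 1)`-st smallest one, `x*_{i+1}`. -/
noncomputable def orderedPts (x : ℕ → ℝ) (N : ℕ) (i : Fin N) : ℝ :=
  x ((Tuple.sort (fun k : Fin N => x (k.val + 1)) i).val + 1)

/-- The gaps of `x₁, …, x_N ∈ [0,1)` on the circle: the gap at `i` is the one between `x*_{i+1}`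
and `x*_{i+2}`, and the last gap runs from `x*_N` through `1 = 0` to `x*_1`. -/
noncomputable def gap (x : ℕ → ℝ) (N : ℕ) (i : Fin N) : ℝ :=
  if h : i.val + 1 < N then orderedPts x N ⟨i.val + 1, h⟩ - orderedPts x N i
  else 1 + orderedPts x N ⟨0, i.pos⟩ - orderedPts x N i

/-- The set of the distinct gap lengths `L_1 < ⋯ < L_K` of `x₁, …, x_N`. -/
noncomputable def gapLengths (x : ℕ → ℝ) (N : ℕ) : Finset ℝ := univ.image (gap x N)

/-- The multiplicity of the gap length `L` among the `N` gaps of `x₁, …, x_N`. -/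
noncomputable def gapMult (x : ℕ → ℝ) (N : ℕ) (L : ℝ) : ℕ :=
  #{i : Fin N | gap x N i = L}

/-- The number of gaps of length `L` between `x*_1` and `x*_{j+1}` (`j : Fin N`). -/
noncomputable def gapCount (x : ℕ → ℝ) (N : ℕ) (j : Fin N) (L : ℝ) : ℕ :=
  #{i : Fin N | i < j ∧ gap x N i = L}

/-- For every `N` the points `x₁, …, x_N` have at most `K` different gap lengths. -/
def FiniteGapProperty (x : ℕ → ℝ) (K : ℕ) : Prop := ∀ N : ℕ, #(gapLengths x N) ≤ K

/-- The quantitative gap condition on `x₁, …, x_N`: the largest gap length is `(ρ + 2) / N` with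
`ρ > -1`, and for every `j = 1, …, N` one has `x*_j = x*_1 + ∑_L n_L(j) L`, where the number
`n_L(j)` of gaps of length `L` between `x*_1` and `x*_j` differs from `(N_L / N) j` by at
most `ε`, with `N_L` the multiplicity of `L`. (The index `j` is `i + 1` for `i : Fin N`.) -/
structure GapCondition (x : ℕ → ℝ) (N : ℕ) (ρ ε : ℝ) : Prop where
  neg_one_lt : -1 < ρ
  largest : IsGreatest (gapLengths x N : Set ℝ) ((ρ + 2) / N)
  position : ∀ i : Fin N, orderedPts x N i =
    orderedPts x N ⟨0, i.pos⟩ + ∑ L ∈ gapLengths x N, (gapCount x N i L : ℝ) * L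
  count : ∀ i : Fin N, ∀ L ∈ gapLengths x N,
    |(gapCount x N i L : ℝ) - (gapMult x N L : ℝ) / N * (i.val + 1 : ℝ)| ≤ ε

/-- The star-discrepancy of `x₁, …, x_N ∈ [0,1)`: the supremum over all `[0,b) ⊆ [0,1)`. -/
noncomputable def starDiscrepancy (x : ℕ → ℝ) (N : ℕ) : ℝ :=
  ⨆ b : Set.Icc (0 : ℝ) 1, |(#{n ∈ Icc 1 N | x n ∈ Set.Ico 0 (b : ℝ)} : ℝ) / N - (b : ℝ)|

/-- A sequence in `[0,1)` is a low-discrepancy sequence: its star-discrepancy is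
`O(N⁻¹ log N)`. -/
def IsLowDiscrepancy (x : ℕ → ℝ) : Prop :=
  Asymptotics.IsBigO Filter.atTop (fun N : ℕ => starDiscrepancy x N)
    (fun N : ℕ => Real.log N / N)

/-! Bounded partial quotients make `z` badly approximable: `|z - r| ≥ c / r.den ^ 2` with `c = 1 /
(R + 2)` (`PartialQuotientsLE.le_abs_sub_rat`). Everything quantitative follows from this and the
three gap theorem.

Discrepancy (`abs_visitCount_sub_le`): Dirichlet gives `q ≤ M` such that any `q` consecutive terms
are equidistributed up to `O(1)`, and bad approximability forces `q ≥ c M`. Splitting off such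
blocks exhausts `M` terms after `O(log M / c)` steps, wherever the block of indices starts.

Gaps (`exists_threeGap`): the gap to the right of `n z` depends only on how `n` compares with two
thresholds, so the indices carrying a given length form a block of `M` consecutive integers. Hence
`n_k(j)` counts visits of a block to `[0, x_j*)` and is `M x_j* + O(log N)`, while `j = N x_j* +
O(log N)`. Eliminating `x_j*` gives the count estimate. -/

/-! ### Continued fractions and bad approximability -/

theorem exists_stream_eq_some_of_irrational {z : ℝ} (hz : Irrational z) (n : ℕ) :
    ∃ p, GenContFract.IntFractPair.stream z n = some p ∧ Irrational p.fr := by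
  induction n with
  | zero =>
    refine ⟨_, GenContFract.IntFractPair.stream_zero z, ?_⟩
    exact hz.sub_intCast ⌊z⌋
  | succ n ih =>
    obtain ⟨p, hp, hirr⟩ := ih
    refine ⟨_, GenContFract.IntFractPair.stream_succ_of_some hp hirr.ne_zero, ?_⟩
    exact hirr.inv.sub_intCast ⌊p.fr⁻¹⌋

theorem exists_int_contsAux (z : ℝ) (n : ℕ) :
    ∃ a b : ℤ, (GenContFract.of z).contsAux n = ⟨a, b⟩ := by
  induction n using Nat.strong_induction_on with
  | _ n ih =>
    match n with
    | 0 => exact ⟨1, 0, by simp [GenContFract.contsAux]⟩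
    | 1 => exact ⟨⌊z⌋, 1, by simp [GenContFract.contsAux]⟩
    | n + 2 =>
      obtain ⟨a₀, b₀, h₀⟩ := ih n (by lia)
      obtain ⟨a₁, b₁, h₁⟩ := ih (n + 1) (by lia)
      cases hs : (GenContFract.of z).s.get? n with
      | none => exact ⟨a₁, b₁, by simp [GenContFract.contsAux, hs, h₁]⟩
      | some gp =>
        obtain ⟨ha, k, hk⟩ := GenContFract.of_partNum_eq_one_and_exists_int_partDen_eq hs
        refine ⟨k * a₁ + a₀, k * b₁ + b₀, ?_⟩
        rw [GenContFract.contsAux_recurrence hs h₀ h₁]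
        simp [ha, hk]

/-- The denominator of a convergent, in lowest terms, is its continuant. -/
theorem den_eq_dens_of_convs_eq {z : ℝ} (hz : Irrational z) {n : ℕ} {r : ℚ}
    (h : (GenContFract.of z).convs n = r) : (r.den : ℝ) = (GenContFract.of z).dens n := by
  have hnt (k : ℕ) : ¬ (GenContFract.of z).TerminatedAt k := by
    obtain ⟨p, hp, -⟩ := exists_stream_eq_some_of_irrational hz (k + 1)
    rw [GenContFract.of_terminatedAt_n_iff_succ_nth_intFractPair_stream_eq_none, hp]
    simp
  obtain ⟨a, b, hab⟩ := exists_int_contsAux z (n + 1)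
  obtain ⟨a', b', hab'⟩ := exists_int_contsAux z (n + 2)
  have hA : (GenContFract.of z).nums n = a := by
    rw [GenContFract.num_eq_conts_a, GenContFract.nth_cont_eq_succ_nth_contAux, hab]
  have hB : (GenContFract.of z).dens n = b := by
    rw [GenContFract.den_eq_conts_b, GenContFract.nth_cont_eq_succ_nth_contAux, hab]
  have hA' : (GenContFract.of z).nums (n + 1) = a' := by
    rw [GenContFract.num_eq_conts_a, GenContFract.nth_cont_eq_succ_nth_contAux, hab']
  have hB' : (GenContFract.of z).dens (n + 1) = b' := by
    rw [GenContFract.den_eq_conts_b, GenContFract.nth_cont_eq_succ_nth_contAux, hab']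
  have hdet := SimpContFract.determinant (s := SimpContFract.of z) (hnt n)
  change (GenContFract.of z).nums n * (GenContFract.of z).dens (n + 1) -
    (GenContFract.of z).dens n * (GenContFract.of z).nums (n + 1) = _ at hdet
  rw [hA, hB, hA', hB'] at hdet
  have hdet' : a * b' - b * a' = (-1) ^ (n + 1) := by exact_mod_cast hdet
  -- The determinant identity, read over `ℤ`, is a Bézout relation.
  have hcop : IsCoprime a b := by
    refine ⟨(-1) ^ (n + 1) * b', -(-1) ^ (n + 1) * a', ?_⟩
    have : ((-1 : ℤ) ^ (n + 1)) * (-1) ^ (n + 1) = 1 := by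
      rw [← mul_pow]; simp
    linear_combination (-1) ^ (n + 1) * hdet' + this
  have hbpos : 0 < b := by
    have : (Nat.fib (n + 1) : ℝ) ≤ (GenContFract.of z).dens n :=
      GenContFract.succ_nth_fib_le_of_nth_den (Or.inr (hnt _))
    rw [hB] at this
    have h1 : 0 < Nat.fib (n + 1) := Nat.fib_pos.2 (by lia)
    have : (Nat.fib (n + 1) : ℤ) ≤ b := by exact_mod_cast this
    lia
  have hr : r = (a : ℚ) / b := by
    have : (r : ℝ) = (a : ℝ) / b := by
      rw [← h, GenContFract.conv_eq_num_div_den, hA, hB]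
    exact_mod_cast this
  have hden : ((r.den : ℕ) : ℤ) = b := by
    rw [hr]
    exact Rat.den_div_eq_of_coprime hbpos (Int.isCoprime_iff_nat_coprime.1 hcop)
  rw [hB, ← hden]
  simp

/-- A number with bounded partial quotients is badly approximable. -/
theorem PartialQuotientsLE.le_abs_sub_rat {z : ℝ} {R : ℕ} (hz : Irrational z)
    (h : PartialQuotientsLE z R) (r : ℚ) :
    1 / ((R + 2 : ℝ) * (r.den : ℝ) ^ 2) ≤ |z - r| := by
  have hd : (1 : ℝ) ≤ r.den := by exact_mod_cast r.pos
  -- By Legendre's criterion, `r` is a convergent in this range; outside it `R + 2 ≥ 2` suffices.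
  by_cases hr : |z - r| < 1 / (2 * (r.den : ℝ) ^ 2)
  swap
  · refine le_trans ?_ (not_lt.1 hr)
    gcongr
    linarith [(Nat.cast_nonneg R : (0 : ℝ) ≤ R)]
  obtain ⟨n, hn⟩ := Real.exists_convs_eq_rat hr
  have hB := den_eq_dens_of_convs_eq hz hn
  obtain ⟨p, hp, hirr⟩ := exists_stream_eq_some_of_irrational hz n
  -- The error is `1 / (B (p.fr⁻¹ B + B'))` with consecutive denominators `B' ≤ B`; since `p.fr⁻¹ <
  -- R + 1`, the bracket is at most `(R + 2) B`.
  have hsub := GenContFract.sub_convs_eq hp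
  simp only [hirr.ne_zero, if_false] at hsub
  rw [GenContFract.den_eq_conts_b, GenContFract.nth_cont_eq_succ_nth_contAux] at hB
  have hpB : ((GenContFract.of z).contsAux n).b ≤ ((GenContFract.of z).contsAux (n + 1)).b := by
    cases n with
    | zero => simp [GenContFract.contsAux]
    | succ n =>
      have := GenContFract.of_den_mono (v := z) (n := n)
      simpa only [GenContFract.den_eq_conts_b, GenContFract.nth_cont_eq_succ_nth_contAux] using this
  have hpB0 : 0 ≤ ((GenContFract.of z).contsAux n).b := GenContFract.zero_le_of_contsAux_b
  rw [hn, ← hB] at hsub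
  rw [← hB] at hpB
  have hs := GenContFract.get?_of_eq_some_of_get?_intFractPair_stream_fr_ne_zero hp hirr.ne_zero
  have hle := h n _ (GenContFract.partDen_eq_s_b hs)
  simp only [GenContFract.IntFractPair.of] at hle
  have hfr : p.fr⁻¹ < R + 1 := by linarith [Int.lt_floor_add_one p.fr⁻¹]
  have hfr0 : 0 ≤ p.fr⁻¹ := inv_nonneg.2 (GenContFract.IntFractPair.nth_stream_fr_nonneg hp)
  have hfrpos : 0 < p.fr⁻¹ := lt_of_le_of_ne hfr0 (inv_ne_zero hirr.ne_zero).symm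
  rw [hsub, abs_div, abs_pow, abs_neg, abs_one, one_pow]
  rw [abs_of_nonneg (by positivity)]
  apply one_div_le_one_div_of_le (by positivity)
  nlinarith [mul_le_mul_of_nonneg_right hfr.le (by positivity : (0 : ℝ) ≤ r.den)]

/-! ### Discrepancy of blocks of consecutive terms -/

theorem kronecker_nonneg (z : ℝ) (n : ℕ) : 0 ≤ kronecker z n := Int.fract_nonneg _

theorem kronecker_lt_one (z : ℝ) (n : ℕ) : kronecker z n < 1 := Int.fract_lt_one _

theorem card_Icc_ceil_floor_le {a b : ℝ} (hab : a ≤ b) : (#(Icc ⌈a⌉ ⌊b⌋) : ℝ) ≤ b - a + 1 := by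
  rw [Int.card_Icc]
  have h1 := Int.floor_le b
  have h2 := Int.le_ceil a
  rcases le_total 0 (⌊b⌋ + 1 - ⌈a⌉) with h | h
  · have : (((⌊b⌋ + 1 - ⌈a⌉).toNat : ℤ) : ℝ) = ((⌊b⌋ + 1 - ⌈a⌉ : ℤ) : ℝ) := by
      rw [Int.toNat_of_nonneg h]
    rw [Int.cast_natCast] at this
    rw [this]
    push_cast
    linarith
  · rw [Int.toNat_of_nonpos h]
    simp
    linarith

/-- The number of indices `n ∈ [m, m + M)` with `{n z} ∈ [a, b)`. -/
noncomputable def visitCount (z : ℝ) (m M : ℕ) (a b : ℝ) : ℕ :=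
  #{n ∈ Ico m (m + M) | kronecker z n ∈ Set.Ico a b}

theorem visitCount_add_length (z : ℝ) (m M M' : ℕ) (a b : ℝ) :
    visitCount z m (M + M') a b = visitCount z m M a b + visitCount z (m + M) M' a b := by
  unfold visitCount
  rw [← Ico_union_Ico_eq_Ico (by lia : m ≤ m + M) (by lia : m + M ≤ m + (M + M')), filter_union,
    card_union_of_disjoint, add_assoc]
  exact disjoint_filter_filter (Ico_disjoint_Ico_consecutive _ _ _)

theorem visitCount_add_interval (z : ℝ) (m M : ℕ) {a b c : ℝ} (hab : a ≤ b) (hbc : b ≤ c) :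
    visitCount z m M a c = visitCount z m M a b + visitCount z m M b c := by
  unfold visitCount
  rw [← card_union_of_disjoint, ← filter_or]
  · congr 1
    ext n
    simp only [mem_filter, Set.mem_Ico]
    grind
  · rw [disjoint_filter]
    simp only [Set.mem_Ico]
    grind

theorem visitCount_zero_one (z : ℝ) (m M : ℕ) : visitCount z m M 0 1 = M := by
  simp [visitCount, kronecker_nonneg, kronecker_lt_one]

/-- A block of `q` consecutive terms, `q` the denominator of a good approximation. -/
theorem visitCount_den_le {z : ℝ} {r : ℚ} (hr : |z - r| ≤ 1 / (r.den : ℝ) ^ 2) (m : ℕ) {a b : ℝ}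
    (hab : a ≤ b) : (visitCount z m r.den a b : ℝ) ≤ r.den * (b - a) + 3 := by
  set q := r.den with hq
  have hqpos : 0 < q := r.pos
  have hq0 : (0 : ℝ) < q := by exact_mod_cast hqpos
  -- An integer within `1` of `q {n z} - q m z`. Modulo `q` it is `(n - m) * r.num`, hence injective
  -- on a block of length `q`, so counting visits reduces to counting integers in `[L, U]`.
  let f : ℕ → ℤ := fun n => ((n : ℤ) - m) * r.num - q * ⌊(n : ℝ) * z⌋
  set L : ℝ := q * a - q * m * z - 1 with hL
  set U : ℝ := q * b - q * m * z + 1 with hU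
  have hLU : L ≤ U := by nlinarith
  have hnum : (r.num : ℝ) = q * r := by
    rw [mul_comm]
    exact_mod_cast (Rat.mul_den_eq_num r).symm
  have hmaps : ∀ n ∈ ({n ∈ Ico m (m + q) | kronecker z n ∈ Set.Ico a b} : Finset ℕ),
      f n ∈ Icc ⌈L⌉ ⌊U⌋ := by
    intro n hn
    simp only [mem_filter, mem_Ico, Set.mem_Ico, kronecker, Int.fract] at hn
    obtain ⟨⟨h1, h2⟩, h3, h4⟩ := hn
    have h1' : (m : ℝ) ≤ n := by exact_mod_cast h1
    have h2' : (n : ℝ) - m ≤ q := by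
      have : (n : ℝ) ≤ m + q := by exact_mod_cast h2.le
      linarith
    have hfn : (f n : ℝ) = q * (n * z - ⌊(n : ℝ) * z⌋) - q * m * z - (n - m) * q * (z - r) := by
      simp only [f]
      push_cast
      rw [hnum]
      ring
    have herr : |((n : ℝ) - m) * q * (z - r)| ≤ 1 := by
      rw [abs_mul, abs_of_nonneg (mul_nonneg (by linarith) hq0.le)]
      calc ((n : ℝ) - m) * q * |z - r| ≤ q * q * (1 / (q : ℝ) ^ 2) := by gcongr
        _ = 1 := by field_simp
    obtain ⟨he1, he2⟩ := abs_le.1 herr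
    rw [mem_Icc, Int.ceil_le, Int.le_floor, hfn]
    constructor <;> nlinarith
  have hinj : Set.InjOn f ({n ∈ Ico m (m + q) | kronecker z n ∈ Set.Ico a b} : Finset ℕ) := by
    intro n hn n' hn' h
    simp only [coe_filter, mem_Ico, Set.mem_ofPred_eq] at hn hn'
    have hdvd : (q : ℤ) ∣ ((n : ℤ) - n') * r.num :=
      ⟨⌊(n : ℝ) * z⌋ - ⌊(n' : ℝ) * z⌋, by simp only [f] at h; linear_combination h⟩
    have hcop : IsCoprime (q : ℤ) r.num :=
      Int.isCoprime_iff_nat_coprime.2 (by simpa using r.reduced.symm)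
    have := hcop.dvd_of_dvd_mul_right hdvd
    have := Int.eq_zero_of_abs_lt_dvd this (by rw [abs_lt]; constructor <;> lia)
    lia
  calc (visitCount z m q a b : ℝ) ≤ #(Icc ⌈L⌉ ⌊U⌋) := by
        exact_mod_cast card_le_card_of_injOn f hmaps hinj
    _ ≤ U - L + 1 := card_Icc_ceil_floor_le hLU
    _ = q * (b - a) + 3 := by rw [hL, hU]; ring

/-- The lower bound comes from the upper bounds on the two complementary intervals, whence `6 = 3 +
3`. -/
theorem abs_visitCount_den_sub_le {z : ℝ} {r : ℚ} (hr : |z - r| ≤ 1 / (r.den : ℝ) ^ 2) (m : ℕ)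
    {a b : ℝ} (ha : 0 ≤ a) (hab : a ≤ b) (hb : b ≤ 1) :
    |(visitCount z m r.den a b : ℝ) - r.den * (b - a)| ≤ 6 := by
  have h1 := visitCount_den_le hr m hab
  have h2 := visitCount_den_le hr m ha
  have h3 := visitCount_den_le hr m hb
  have h4 : (visitCount z m r.den 0 1 : ℝ) =
      visitCount z m r.den 0 a + visitCount z m r.den a b + visitCount z m r.den b 1 := by
    rw [visitCount_add_interval z m r.den ha (hab.trans hb),
      visitCount_add_interval z m r.den hab hb]
    push_cast
    ring
  rw [visitCount_zero_one] at h4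
  rw [abs_le]
  constructor <;> linarith

/-- The discrepancy of any block of a Kronecker sequence with badly approximable `z`. -/
theorem abs_visitCount_sub_le {z c : ℝ} (hc : 0 < c)
    (hz : ∀ r : ℚ, c / (r.den : ℝ) ^ 2 ≤ |z - r|) (m : ℕ) {M : ℕ} (hM : 0 < M)
    {a b : ℝ} (ha : 0 ≤ a) (hab : a ≤ b) (hb : b ≤ 1) :
    |(visitCount z m M a b : ℝ) - M * (b - a)| ≤ 6 * (1 + Real.log M / c) := by
  induction M using Nat.strong_induction_on generalizing m with
  | _ M ih =>
    obtain ⟨r, hr, hden⟩ := Real.exists_rat_abs_sub_le_and_den_le z hM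
    have hd : (0 : ℝ) < r.den := by exact_mod_cast r.pos
    have hM0 : (0 : ℝ) < M := by exact_mod_cast hM
    have hden' : (r.den : ℝ) ≤ M := by exact_mod_cast hden
    have hr' : |z - r| ≤ 1 / (r.den : ℝ) ^ 2 := by
      refine hr.trans (one_div_le_one_div_of_le (by positivity) ?_)
      nlinarith
    have hlarge : c * M ≤ r.den := by
      have := (hz r).trans hr
      rw [div_le_div_iff₀ (by positivity) (by positivity)] at this
      have : c * (M + 1) ≤ r.den := by
        apply le_of_mul_le_mul_right _ hd
        linarith
      linarith
    obtain ⟨M', rfl⟩ := Nat.exists_eq_add_of_le hden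
    have hblock := abs_visitCount_den_sub_le hr' m ha hab hb
    rcases Nat.eq_zero_or_pos M' with rfl | hM'
    · simp only [add_zero]
      have : 0 ≤ Real.log r.den / c :=
        div_nonneg (Real.log_natCast_nonneg _) hc.le
      linarith
    · have hrest := ih M' (by have := r.pos; lia) (m + r.den) hM'
      have hM'0 : (0 : ℝ) < M' := by exact_mod_cast hM'
      -- The remainder has length at most `(1 - c) M`, so `log` drops by at least `c`, which pays
      -- for the removed block.
      have hlog : 1 + Real.log M' / c ≤ Real.log ((r.den + M' : ℕ) : ℝ) / c := by
        rw [le_div_iff₀ hc, add_mul, div_mul_cancel₀ _ hc.ne', one_mul]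
        have h1 : Real.log ((M' : ℝ) / ((r.den + M' : ℕ) : ℝ)) ≤
            (M' : ℝ) / ((r.den + M' : ℕ) : ℝ) - 1 := Real.log_le_sub_one_of_pos (by positivity)
        rw [Real.log_div hM'0.ne' hM0.ne'] at h1
        have h2 : (M' : ℝ) / ((r.den + M' : ℕ) : ℝ) ≤ 1 - c := by
          rw [div_le_iff₀ hM0]
          push_cast at hlarge ⊢
          linarith
        linarith
      rw [visitCount_add_length]
      push_cast
      push_cast at hlog
      calc |(visitCount z m r.den a b + visitCount z (m + r.den) M' a b : ℝ)
            - (r.den + M') * (b - a)|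
          = |((visitCount z m r.den a b : ℝ) - r.den * (b - a))
            + (visitCount z (m + r.den) M' a b - M' * (b - a))| := by ring_nf
        _ ≤ _ := abs_add_le _ _
        _ ≤ _ := by linarith

/-! ### Ordered points and gaps -/

/-- The index `n` with `x n = x*_{i+1}`. -/
noncomputable def orderIndex (x : ℕ → ℝ) (N : ℕ) (i : Fin N) : ℕ :=
  (Tuple.sort (fun k : Fin N => x (k.val + 1)) i).val + 1

theorem orderIndex_mem (x : ℕ → ℝ) (N : ℕ) (i : Fin N) : orderIndex x N i ∈ Icc 1 N := by
  simp only [orderIndex, mem_Icc]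
  have := (Tuple.sort (fun k : Fin N => x (k.val + 1)) i).isLt
  lia

theorem orderIndex_injective (x : ℕ → ℝ) (N : ℕ) : Function.Injective (orderIndex x N) := by
  intro i j h
  simp only [orderIndex, Nat.add_right_cancel_iff] at h
  exact (Tuple.sort _).injective (Fin.ext h)

theorem exists_orderIndex_eq (x : ℕ → ℝ) {N n : ℕ} (hn : n ∈ Icc 1 N) :
    ∃ i, orderIndex x N i = n := by
  obtain ⟨h1, h2⟩ := mem_Icc.1 hn
  refine ⟨(Tuple.sort (fun k : Fin N => x (k.val + 1))).symm ⟨n - 1, by lia⟩, ?_⟩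
  simp only [orderIndex, Equiv.apply_symm_apply]
  lia

theorem sum_orderIndex {α : Type*} [AddCommMonoid α] (x : ℕ → ℝ) (N : ℕ) (f : ℕ → α) :
    ∑ i : Fin N, f (orderIndex x N i) = ∑ n ∈ Icc 1 N, f n :=
  sum_bij (fun i _ => orderIndex x N i) (fun i _ => orderIndex_mem x N i)
    (fun _ _ _ _ h => orderIndex_injective x N h)
    (fun _ hn => (exists_orderIndex_eq x hn).imp fun _ h => ⟨mem_univ _, h⟩) (fun _ _ => rfl)

theorem card_orderIndex (x : ℕ → ℝ) (N : ℕ) (P : ℕ → Prop) [DecidablePred P] :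
    #{i : Fin N | P (orderIndex x N i)} = #{n ∈ Icc 1 N | P n} := by
  rw [card_filter, card_filter]
  exact sum_orderIndex x N fun n => if P n then 1 else 0

theorem strictMono_orderedPts {x : ℕ → ℝ} (hx : Function.Injective x) (N : ℕ) :
    StrictMono (orderedPts x N) := by
  refine Monotone.strictMono_of_injective
    (Tuple.monotone_sort fun k : Fin N => x (k.val + 1)) ?_
  intro i j h
  exact orderIndex_injective x N (hx h)

theorem sum_gap_Iio (x : ℕ → ℝ) (N : ℕ) (i : Fin N) :
    ∑ k ∈ Iio i, gap x N k = orderedPts x N i - orderedPts x N ⟨0, i.pos⟩ := by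
  obtain ⟨i, hi⟩ := i
  induction i with
  | zero =>
    have : Iio (⟨0, hi⟩ : Fin N) = ∅ := by
      ext k
      simp [Fin.lt_def]
    simp [this]
  | succ i ih =>
    have : Iio (⟨i + 1, hi⟩ : Fin N) = insert ⟨i, by lia⟩ (Iio ⟨i, by lia⟩) := by
      ext k
      simp only [mem_Iio, mem_insert, Fin.lt_def, Fin.ext_iff]
      lia
    rw [this, sum_insert (by simp), ih (by lia), gap, dif_pos hi]
    ring

theorem sum_gap (x : ℕ → ℝ) {N : ℕ} (hN : 0 < N) : ∑ k, gap x N k = 1 := by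
  have : (univ : Finset (Fin N)) = insert ⟨N - 1, by lia⟩ (Iio ⟨N - 1, by lia⟩) := by
    ext k
    simp only [mem_Iio, mem_insert, mem_univ, Fin.lt_def, Fin.ext_iff]
    lia
  rw [this, sum_insert (by simp), sum_gap_Iio, gap, dif_neg (by simp; lia)]
  ring

theorem orderedPts_eq_add_sum_gapCount (x : ℕ → ℝ) (N : ℕ) (i : Fin N) :
    orderedPts x N i =
      orderedPts x N ⟨0, i.pos⟩ + ∑ L ∈ gapLengths x N, (gapCount x N i L : ℝ) * L := by
  rw [← sub_eq_iff_eq_add', ← sum_gap_Iio, ← sum_fiberwise_of_maps_to (g := gap x N)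
    (t := gapLengths x N) (fun k _ => mem_image_of_mem _ (mem_univ k))]
  refine sum_congr rfl fun L _ => ?_
  rw [sum_congr rfl (fun k hk => (mem_filter.1 hk).2), sum_const, nsmul_eq_mul, gapCount]
  congr 3
  ext k
  simp

theorem fract_sub_of_lt {a b : ℝ} (ha : 0 ≤ a) (hb : b < 1) (h : a ≤ b) :
    Int.fract (b - a) = b - a :=
  Int.fract_eq_self.2 ⟨by linarith, by linarith⟩

theorem fract_sub_of_gt {a b : ℝ} (ha : a < 1) (hb : 0 ≤ b) (h : b < a) :
    Int.fract (b - a) = 1 + b - a := by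
  rw [← Int.fract_add_one, Int.fract_eq_self.2 ⟨by linarith, by linarith⟩]
  ring

/-- A gap is the distance to the next point on the circle, counterclockwise. -/
theorem gap_le_fract {x : ℕ → ℝ} (hx : Function.Injective x) (h0 : ∀ n, 0 ≤ x n)
    (h1 : ∀ n, x n < 1) {N : ℕ} {i j : Fin N} (hij : j ≠ i) :
    gap x N i ≤ Int.fract (orderedPts x N j - orderedPts x N i) := by
  have hmono := strictMono_orderedPts hx N
  have hn (k : Fin N) : 0 ≤ orderedPts x N k := h0 _
  have hl (k : Fin N) : orderedPts x N k < 1 := h1 _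
  rcases lt_or_gt_of_ne hij with h | h
  · rw [fract_sub_of_gt (hl i) (hn j) (hmono h), gap]
    split_ifs with hi
    · linarith [hl ⟨i.val + 1, hi⟩, hn j]
    · have : orderedPts x N ⟨0, i.pos⟩ ≤ orderedPts x N j := hmono.monotone (by simp [Fin.le_def])
      linarith
  · have hi : i.val + 1 < N := by
      have := j.isLt
      rw [Fin.lt_def] at h
      lia
    rw [fract_sub_of_lt (hn i) (hl j) (hmono h).le, gap, dif_pos hi]
    have : orderedPts x N ⟨i.val + 1, hi⟩ ≤ orderedPts x N j := hmono.monotone h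
    linarith

theorem exists_gap_eq_fract {x : ℕ → ℝ} (hx : Function.Injective x) (h0 : ∀ n, 0 ≤ x n)
    (h1 : ∀ n, x n < 1) {N : ℕ} (hN : 2 ≤ N) (i : Fin N) :
    ∃ j, j ≠ i ∧ gap x N i = Int.fract (orderedPts x N j - orderedPts x N i) := by
  have hmono := strictMono_orderedPts hx N
  have hn (k : Fin N) : 0 ≤ orderedPts x N k := h0 _
  have hl (k : Fin N) : orderedPts x N k < 1 := h1 _
  by_cases hi : i.val + 1 < N
  · have hlt : i < ⟨i.val + 1, hi⟩ := by simp [Fin.lt_def]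
    refine ⟨⟨i.val + 1, hi⟩, hlt.ne', ?_⟩
    rw [fract_sub_of_lt (hn i) (hl _) (hmono hlt).le, gap, dif_pos hi]
  · have hlt : (⟨0, i.pos⟩ : Fin N) < i := by
      rw [Fin.lt_def]
      simp only
      lia
    refine ⟨⟨0, i.pos⟩, hlt.ne, ?_⟩
    rw [fract_sub_of_gt (hl i) (hn _) (hmono hlt), gap, dif_neg hi]

/-! ### The three gap theorem -/

theorem kronecker_injective {z : ℝ} (hz : Irrational z) : Function.Injective (kronecker z) := by
  intro m n h
  by_contra hmn
  obtain ⟨k, hk⟩ := Int.fract_eq_fract.1 h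
  have : ((m : ℤ) - n : ℤ) ≠ 0 := by lia
  apply (hz.intCast_mul this).ne_int k
  push_cast
  linarith

theorem fract_kronecker_sub (z : ℝ) (m n : ℕ) :
    Int.fract (kronecker z m - kronecker z n) = Int.fract ((((m : ℤ) - n : ℤ) : ℝ) * z) := by
  rw [Int.fract_eq_fract]
  refine ⟨⌊(n : ℝ) * z⌋ - ⌊(m : ℝ) * z⌋, ?_⟩
  simp only [kronecker, Int.fract]
  push_cast
  ring

theorem fract_sub_mul {z : ℝ} {d e : ℤ} (h : Int.fract ((e : ℝ) * z) ≤ Int.fract ((d : ℝ) * z)) :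
    Int.fract (((d - e : ℤ) : ℝ) * z) = Int.fract ((d : ℝ) * z) - Int.fract ((e : ℝ) * z) := by
  rw [← fract_sub_of_lt (Int.fract_nonneg _) (Int.fract_lt_one _) h, Int.fract_eq_fract]
  refine ⟨⌊(d : ℝ) * z⌋ - ⌊(e : ℝ) * z⌋, ?_⟩
  simp only [Int.fract]
  push_cast
  ring

theorem fract_mul_pos {z : ℝ} (hz : Irrational z) {d : ℤ} (hd : d ≠ 0) :
    0 < Int.fract ((d : ℝ) * z) := by
  rw [Int.fract_pos]
  exact (hz.intCast_mul hd).ne_int _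

/-- The **three gap theorem**: `p` and `q` are the indices of the points closest to `0` on either
side, and the gap to the right of `n z` is `‖p z‖`, `‖q z‖` or `‖p z‖ + ‖q z‖`. -/
theorem exists_threeGap {z : ℝ} (hz : Irrational z) {N : ℕ} (hN : 2 ≤ N) :
    ∃ p q : ℕ, 0 < p ∧ 0 < q ∧ p < N ∧ q < N ∧ N ≤ p + q ∧ ∀ i : Fin N,
      gap (kronecker z) N i =
        (if orderIndex (kronecker z) N i ≤ q then Int.fract ((p : ℝ) * z) else 0) +
        (if N < p + orderIndex (kronecker z) N i then Int.fract (-(q : ℝ) * z) else 0) := by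
  obtain ⟨p, hp, hpmin⟩ := exists_min_image (Icc 1 (N - 1)) (fun d : ℕ => Int.fract ((d : ℝ) * z))
    ⟨1, by simp; lia⟩
  obtain ⟨q, hq, hqmin⟩ := exists_min_image (Icc 1 (N - 1)) (fun d : ℕ => Int.fract (-(d : ℝ) * z))
    ⟨1, by simp; lia⟩
  rw [mem_Icc] at hp hq
  set F : ℤ → ℝ := fun d => Int.fract ((d : ℝ) * z) with hF
  have hA : Int.fract ((p : ℝ) * z) = F p := by simp [hF]
  have hB : Int.fract (-(q : ℝ) * z) = F (-q) := by simp [hF]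
  have hpm (d : ℤ) (h1 : 1 ≤ d) (h2 : d < N) : F p ≤ F d := by
    have := hpmin d.toNat (by rw [mem_Icc]; lia)
    have hd : ((d.toNat : ℕ) : ℝ) = (d : ℝ) := by
      exact_mod_cast congrArg (Int.cast (R := ℝ)) (Int.toNat_of_nonneg (by lia : 0 ≤ d))
    rwa [hd, hA] at this
  have hqm (d : ℤ) (h1 : 1 ≤ d) (h2 : d < N) : F (-q) ≤ F (-d) := by
    have := hqmin d.toNat (by rw [mem_Icc]; lia)
    have hd : ((d.toNat : ℕ) : ℝ) = (d : ℝ) := by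
      exact_mod_cast congrArg (Int.cast (R := ℝ)) (Int.toNat_of_nonneg (by lia : 0 ≤ d))
    rw [hd, hB] at this
    simpa [hF] using this
  have hpos (d : ℤ) (hd : d ≠ 0) : 0 < F d := fract_mul_pos hz hd
  have hsub (d e : ℤ) (h : F e ≤ F d) : F (d - e) = F d - F e := fract_sub_mul h
  have hApos := hpos p (by lia)
  have hBpos := hpos (-q) (by lia)
  -- Otherwise `p + q` is an admissible index, and subtracting the smaller of the two minimal
  -- distances from the larger contradicts minimality.
  have hpq : N ≤ p + q := by
    by_contra! hlt
    rcases le_total (F (-q)) (F p) with h | h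
    · have h1 := hsub _ _ h
      have h2 := hpm (p - -q) (by lia) (by lia)
      linarith
    · have h1 := hsub _ _ h
      have h2 := hqm (q + p) (by lia) (by lia)
      rw [neg_add'] at h2
      linarith
  refine ⟨p, q, hp.1, hq.1, by lia, by lia, hpq, fun i => ?_⟩
  rw [hA, hB]
  set n := orderIndex (kronecker z) N i with hn
  obtain ⟨hn1, hnN⟩ := mem_Icc.1 (orderIndex_mem (kronecker z) N i)
  rw [← hn] at hn1 hnN
  have hgle (m : ℕ) (hm : m ∈ Icc 1 N) (hmn : m ≠ n) : gap (kronecker z) N i ≤ F (m - n) := by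
    obtain ⟨j, rfl⟩ := exists_orderIndex_eq (kronecker z) hm
    have := gap_le_fract (kronecker_injective hz) (kronecker_nonneg z) (kronecker_lt_one z)
      (i := i) (j := j) (by rintro rfl; exact hmn rfl)
    exact this.trans_eq (fract_kronecker_sub z _ _)
  obtain ⟨m, hm, hmn, hgm⟩ : ∃ m ∈ Icc 1 N, m ≠ n ∧ gap (kronecker z) N i = F (m - n) := by
    obtain ⟨j, hji, hj⟩ := exists_gap_eq_fract (kronecker_injective hz) (kronecker_nonneg z)
      (kronecker_lt_one z) hN i
    exact ⟨_, orderIndex_mem _ N j, fun h => hji (orderIndex_injective _ N h),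
      hj.trans (fract_kronecker_sub z _ _)⟩
  rw [mem_Icc] at hm
  rw [hgm]
  have hd0 := hpos (m - n) (by lia)
  -- The right neighbour is `n + p`: a closer point `m < n` would make `p + n - m < N` beat `p`.
  by_cases h1 : n + p ≤ N
  · rw [if_pos (by lia), if_neg (by lia), add_zero]
    apply le_antisymm
    · have := hgle (n + p) (by rw [mem_Icc]; lia) (by lia)
      rw [hgm] at this
      simpa using this
    · rcases lt_or_gt_of_ne hmn with h | h
      · by_contra! hlt
        have h2 := hsub _ _ hlt.le
        have h3 := hpm (p - (m - n)) (by lia) (by lia)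
        linarith
      · exact hpm _ (by lia) (by lia)
  -- Mirror image: the right neighbour is `n - q`.
  by_cases h2 : q < n
  · rw [if_neg (by lia), if_pos (by lia), zero_add]
    apply le_antisymm
    · have := hgle (n - q) (by rw [mem_Icc]; lia) (by lia)
      rw [hgm, Nat.cast_sub h2.le] at this
      simpa using this
    · rcases lt_or_gt_of_ne hmn with h | h
      · have := hqm (n - m) (by lia) (by lia)
        simpa using this
      · by_contra! hlt
        have h3 := hsub _ _ hlt.le
        have h4 := hqm (q + (m - n)) (by lia) (by lia)
        rw [neg_add'] at h4
        linarith
  -- Neither `n + p` nor `n - q` is available. Subtracting `F (-q)` or `F p` from the distance to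
  -- any `m` leaves at least the other minimum, and `n + p - q` attains the sum.
  rw [if_pos (by lia), if_pos (by lia)]
  have hge : F p + F (-q) ≤ F (m - n) := by
    by_contra! hlt
    rcases lt_or_gt_of_ne hmn with h | h
    · have h3 := hqm (n - m) (by lia) (by lia)
      rw [neg_sub] at h3
      have h4 := hsub _ _ h3
      have h5 := hpm (m - n - -q) (by lia) (by lia)
      linarith
    · have h3 := hpm (m - n) (by lia) (by lia)
      have h4 := hsub _ _ h3
      have h5 := hqm (p - (m - n)) (by lia) (by lia)
      rw [neg_sub] at h5
      linarith
  refine le_antisymm ?_ hge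
  have hlt1 : F p + F (-q) < 1 := hge.trans_lt (Int.fract_lt_one _)
  have hadd : F (p - q) = F p + F (-q) := by
    rw [← Int.fract_eq_self.2 ⟨by positivity, hlt1⟩, Int.fract_eq_fract]
    refine ⟨⌊(p : ℝ) * z⌋ + ⌊-(q : ℝ) * z⌋, ?_⟩
    simp only [hF, Int.fract]
    push_cast
    ring
  have hne : p ≠ q := by
    rintro rfl
    have : F ((p : ℤ) - p) = 0 := by simp [hF]
    linarith
  have := hgle (n + p - q) (by rw [mem_Icc]; lia) (by lia)
  rw [hgm, Nat.cast_sub (by lia)] at this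
  rw [← hadd]
  rwa [show ((n + p : ℕ) : ℤ) - q - n = p - q by push_cast; ring] at this

/-! ### Number and size of the gaps -/

theorem div_le_abs_natCast_mul_sub {z c : ℝ} (hc : 0 ≤ c)
    (hz : ∀ r : ℚ, c / (r.den : ℝ) ^ 2 ≤ |z - r|) {d : ℕ} (hd : 0 < d) (k : ℤ) :
    c / d ≤ |(d : ℝ) * z - k| := by
  have hd0 : (0 : ℝ) < d := by exact_mod_cast hd
  have hden : (((k / d : ℚ)).den : ℝ) ≤ d := by
    have : ((Rat.divInt k d).den : ℤ) ≤ d := Int.le_of_dvd (by lia) (Rat.den_dvd k d)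
    rw [Rat.divInt_eq_div] at this
    exact_mod_cast this
  have hden0 : (0 : ℝ) < ((k / d : ℚ)).den := by exact_mod_cast Rat.pos _
  have h : c / (d : ℝ) ^ 2 ≤ |z - k / d| := by
    have := hz (k / d)
    push_cast at this
    refine le_trans ?_ this
    gcongr
  calc c / d = d * (c / (d : ℝ) ^ 2) := by field_simp
    _ ≤ d * |z - k / d| := by gcongr
    _ = |(d : ℝ) * z - k| := by
      rw [← abs_of_pos hd0, ← abs_mul, abs_of_pos hd0]
      congr 1
      field_simp

theorem div_le_fract {z c : ℝ} (hc : 0 ≤ c) (hz : ∀ r : ℚ, c / (r.den : ℝ) ^ 2 ≤ |z - r|)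
    {d : ℕ} (hd : 0 < d) : c / d ≤ Int.fract ((d : ℝ) * z) := by
  have := div_le_abs_natCast_mul_sub hc hz hd ⌊(d : ℝ) * z⌋
  rwa [Int.self_sub_floor, abs_of_nonneg (Int.fract_nonneg _)] at this

theorem div_le_fract_neg {z c : ℝ} (hc : 0 ≤ c) (hz : ∀ r : ℚ, c / (r.den : ℝ) ^ 2 ≤ |z - r|)
    {d : ℕ} (hd : 0 < d) : c / d ≤ Int.fract (-(d : ℝ) * z) := by
  have := div_le_abs_natCast_mul_sub hc hz hd (-⌊-(d : ℝ) * z⌋)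
  rw [← abs_neg] at this
  push_cast at this
  rwa [show -((d : ℝ) * z - -(⌊-(d : ℝ) * z⌋ : ℝ)) = Int.fract (-(d : ℝ) * z) by
    rw [← Int.self_sub_floor]; ring, abs_of_nonneg (Int.fract_nonneg _)] at this

theorem finiteGapProperty_kronecker {z : ℝ} (hz : Irrational z) :
    FiniteGapProperty (kronecker z) 3 := by
  intro N
  rcases lt_or_ge N 2 with hN | hN
  · refine (card_image_le).trans ?_
    rw [card_univ, Fintype.card_fin]
    lia
  obtain ⟨p, q, -, -, -, -, hpq, hgap⟩ := exists_threeGap hz hN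
  set A := Int.fract ((p : ℝ) * z)
  set B := Int.fract (-(q : ℝ) * z)
  have hsub : gapLengths (kronecker z) N ⊆ {A, B, A + B} := by
    intro L hL
    obtain ⟨i, -, rfl⟩ := mem_image.1 hL
    have hi := hgap i
    have hmem := mem_Icc.1 (orderIndex_mem (kronecker z) N i)
    simp only [mem_insert, mem_singleton]
    split_ifs at hi with h1 h2 h2
    · simp [hi]
    · simp [hi]
    · simp [hi]
    · lia
  exact (card_le_card hsub).trans card_le_three

/-- Excludes a largest gap of exactly `1 / N`, making `-1 < ρ` strict. -/
theorem irrational_gap_kronecker {z : ℝ} (hz : Irrational z) {N : ℕ} (hN : 2 ≤ N) (i : Fin N) :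
    Irrational (gap (kronecker z) N i) := by
  obtain ⟨j, hji, hj⟩ := exists_gap_eq_fract (kronecker_injective hz) (kronecker_nonneg z)
    (kronecker_lt_one z) hN i
  have hne : (orderIndex (kronecker z) N j : ℤ) - orderIndex (kronecker z) N i ≠ 0 := by
    have := (orderIndex_injective (kronecker z) N).ne hji
    lia
  rw [hj]
  change Irrational (Int.fract (kronecker z (orderIndex (kronecker z) N j) -
    kronecker z (orderIndex (kronecker z) N i)))
  rw [fract_kronecker_sub]
  exact (hz.intCast_mul hne).sub_intCast _

theorem mul_gap_kronecker_le {z c : ℝ} (hirr : Irrational z) (hc : 0 < c)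
    (hz : ∀ r : ℚ, c / (r.den : ℝ) ^ 2 ≤ |z - r|) {N : ℕ} (hN : 2 ≤ N) (i : Fin N) :
    N * gap (kronecker z) N i ≤ 2 + 2 / c := by
  obtain ⟨p, q, hp, hq, hpN, hqN, hpq, hgap⟩ := exists_threeGap hirr hN
  have hA := div_le_fract hc.le hz hp
  have hB := div_le_fract_neg hc.le hz hq
  set A := Int.fract ((p : ℝ) * z)
  set B := Int.fract (-(q : ℝ) * z)
  have hp0 : (0 : ℝ) < p := by exact_mod_cast hp
  have hq0 : (0 : ℝ) < q := by exact_mod_cast hq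
  have hpq' : (N : ℝ) ≤ p + q := by exact_mod_cast hpq
  have hA0 : 0 < A := lt_of_lt_of_le (by positivity) hA
  have hB0 : 0 < B := lt_of_lt_of_le (by positivity) hB
  -- The gaps sum to `1`; `A` contributes for the `q` indices `n ≤ q`, `B` for the `p` indices `n >
  -- N - p`.
  have hsum : q * A + p * B = 1 := by
    rw [← sum_gap (kronecker z) (by lia : 0 < N), sum_congr rfl fun i _ => hgap i,
      sum_orderIndex (kronecker z) N fun n =>
        (if n ≤ q then A else 0) + (if N < p + n then B else 0),
      sum_add_distrib, ← sum_filter, ← sum_filter, sum_const, sum_const, nsmul_eq_mul,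
      nsmul_eq_mul]
    have h1 : ({n ∈ Icc 1 N | n ≤ q} : Finset ℕ) = Icc 1 q := by
      ext n
      simp only [mem_filter, mem_Icc]
      lia
    have h2 : ({n ∈ Icc 1 N | N < p + n} : Finset ℕ) = Ioc (N - p) N := by
      ext n
      simp only [mem_filter, mem_Icc, mem_Ioc]
      lia
    rw [h1, h2, Nat.card_Icc, Nat.card_Ioc, Nat.add_sub_cancel, Nat.sub_sub_self hpN.le]
  rw [div_le_iff₀ hp0] at hA
  rw [div_le_iff₀ hq0] at hB
  -- Bad approximability gives `c ≤ q B`, and `(q A) (p B) ≤ 1` as both factors are at most `1`.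
  have hpA : p * A ≤ 1 / c := by
    rw [le_div_iff₀ hc]
    calc p * A * c ≤ p * A * (B * q) := by gcongr
      _ = (p * B) * (q * A) := by ring
      _ ≤ 1 * 1 := by
        gcongr
        · nlinarith
        · nlinarith
      _ = 1 := one_mul 1
  have hqB : q * B ≤ 1 / c := by
    rw [le_div_iff₀ hc]
    calc q * B * c ≤ q * B * (A * p) := by gcongr
      _ = (p * B) * (q * A) := by ring
      _ ≤ 1 * 1 := by
        gcongr
        · nlinarith
        · nlinarith
      _ = 1 := one_mul 1
  have hle : gap (kronecker z) N i ≤ A + B := by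
    rw [hgap]
    gcongr
    · split_ifs <;> simp [hA0.le]
    · split_ifs <;> simp [hB0.le]
  calc (N : ℝ) * gap (kronecker z) N i ≤ (p + q) * (A + B) := by
        apply mul_le_mul hpq' hle ?_ (by positivity)
        rw [hgap]
        positivity
    _ = (q * A + p * B) + p * A + q * B := by ring
    _ ≤ 1 + 1 / c + 1 / c := by rw [hsum]; gcongr
    _ ≤ 2 + 2 / c := by
      rw [show 2 / c = 1 / c + 1 / c by ring]
      linarith

/-! ### Gap counts as visit counts -/

theorem gapCount_kronecker {z : ℝ} (hz : Irrational z) {N : ℕ} {L : ℝ} {g : ℕ → ℝ}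
    (hg : ∀ i, gap (kronecker z) N i = g (orderIndex (kronecker z) N i)) (i : Fin N) :
    gapCount (kronecker z) N i L =
      #{n ∈ {n ∈ Icc 1 N | g n = L} | kronecker z n ∈ Set.Ico 0 (orderedPts (kronecker z) N i)} := by
  rw [filter_filter, ← card_orderIndex (kronecker z), gapCount]
  congr 1
  ext k
  have hlt : k < i ↔ kronecker z (orderIndex (kronecker z) N k) < orderedPts (kronecker z) N i :=
    ((strictMono_orderedPts (kronecker_injective hz) N).lt_iff_lt (a := k) (b := i)).symm
  simp only [mem_filter, hg, hlt, Set.mem_Ico, kronecker_nonneg]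
  tauto

theorem gapMult_eq {x : ℕ → ℝ} {N : ℕ} {L : ℝ} {g : ℕ → ℝ}
    (hg : ∀ i, gap x N i = g (orderIndex x N i)) :
    gapMult x N L = #{n ∈ Icc 1 N | g n = L} := by
  rw [← card_orderIndex x, gapMult]
  simp only [hg]

theorem visitCount_orderedPts {z : ℝ} (hz : Irrational z) {N : ℕ} (i : Fin N) :
    visitCount z 1 N 0 (orderedPts (kronecker z) N i) = i.val := by
  have hIcc : Ico 1 (1 + N) = Icc 1 N := by
    ext n
    simp only [mem_Ico, mem_Icc]
    lia
  rw [visitCount, hIcc, ← card_orderIndex (kronecker z)]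
  rw [← Fin.card_Iio i]
  congr 1
  ext k
  have hlt : k < i ↔ kronecker z (orderIndex (kronecker z) N k) < orderedPts (kronecker z) N i :=
    ((strictMono_orderedPts (kronecker_injective hz) N).lt_iff_lt (a := k) (b := i)).symm
  simp [hlt, kronecker_nonneg]

/-- The indices at which a given gap length occurs form an interval. -/
theorem exists_filter_gap_eq_Ico {z : ℝ} (hz : Irrational z) {N : ℕ} (hN : 2 ≤ N) :
    ∃ g : ℕ → ℝ, (∀ i, gap (kronecker z) N i = g (orderIndex (kronecker z) N i)) ∧
      ∀ L ∈ gapLengths (kronecker z) N,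
        ∃ s M, 0 < M ∧ M ≤ N ∧ ({n ∈ Icc 1 N | g n = L} : Finset ℕ) = Ico s (s + M) := by
  obtain ⟨p, q, hp, hq, hpN, hqN, hpq, hgap⟩ := exists_threeGap hz hN
  have hA0 : 0 < Int.fract ((p : ℝ) * z) := by
    simpa using fract_mul_pos hz (d := p) (by lia)
  have hB0 : 0 < Int.fract (-(q : ℝ) * z) := by
    simpa using fract_mul_pos hz (d := -q) (by lia)
  -- Equality would make `(p + q) z` an integer.
  have hAB : Int.fract ((p : ℝ) * z) ≠ Int.fract (-(q : ℝ) * z) := by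
    intro h
    have := fract_sub_mul (z := z) (d := p) (e := -q) (by simp [h])
    have hpos := fract_mul_pos hz (d := p - -q) (by lia)
    simp [h] at this
    simp [this] at hpos
  set A := Int.fract ((p : ℝ) * z)
  set B := Int.fract (-(q : ℝ) * z)
  have hAne := hA0.ne'
  have hBne := hB0.ne'
  refine ⟨fun n => (if n ≤ q then A else 0) + (if N < p + n then B else 0), hgap, ?_⟩
  intro L hL
  obtain ⟨i, -, rfl⟩ := mem_image.1 hL
  have hmem := mem_Icc.1 (orderIndex_mem (kronecker z) N i)
  rw [hgap i]
  set m := orderIndex (kronecker z) N i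
  by_cases h1 : m ≤ q <;> by_cases h2 : N < p + m
  · refine ⟨N - p + 1, p + q - N, by lia, by lia, ?_⟩
    ext n
    by_cases h3 : n ≤ q <;> by_cases h4 : N < p + n <;>
      simp [h1, h2, h3, h4, hAne, hBne] <;> grind
  · refine ⟨1, N - p, by lia, by lia, ?_⟩
    ext n
    by_cases h3 : n ≤ q <;> by_cases h4 : N < p + n <;>
      simp [h1, h2, h3, h4, hBne, hAB.symm] <;> grind
  · refine ⟨q + 1, N - q, by lia, by lia, ?_⟩
    ext n
    by_cases h3 : n ≤ q <;> by_cases h4 : N < p + n <;>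
      simp [h1, h2, h3, h4, hAne, hAB] <;> grind
  · lia

/-- Both the gap count and the rank are compared with `b = x_j*`, each at the cost of one
discrepancy bound; the final `1` arises because only `j - 1` points lie below `x_j*`. -/
theorem abs_gapCount_sub_le {z c : ℝ} (hirr : Irrational z) (hc : 0 < c)
    (hz : ∀ r : ℚ, c / (r.den : ℝ) ^ 2 ≤ |z - r|) {N : ℕ} (hN : 2 ≤ N) (i : Fin N) {L : ℝ}
    (hL : L ∈ gapLengths (kronecker z) N) :
    |(gapCount (kronecker z) N i L : ℝ) - (gapMult (kronecker z) N L : ℝ) / N * (i.val + 1 : ℝ)| ≤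
      2 * (6 * (1 + Real.log N / c)) + 1 := by
  obtain ⟨g, hg, hint⟩ := exists_filter_gap_eq_Ico hirr hN
  obtain ⟨s, M, hM, hMN, hs⟩ := hint L hL
  have hN0 : (0 : ℝ) < N := by exact_mod_cast (by lia : 0 < N)
  have hM0 : (0 : ℝ) < M := by exact_mod_cast hM
  have hMN' : (M : ℝ) ≤ N := by exact_mod_cast hMN
  set b := orderedPts (kronecker z) N i with hb
  have hb0 : 0 ≤ b := kronecker_nonneg z _
  have hb1 : b ≤ 1 := (kronecker_lt_one z _).le
  have hcount : gapCount (kronecker z) N i L = visitCount z s M 0 b := by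
    rw [gapCount_kronecker hirr hg, hs, visitCount]
  have hmult : gapMult (kronecker z) N L = M := by
    rw [gapMult_eq hg, hs, Nat.card_Ico, Nat.add_sub_cancel_left]
  rw [hcount, hmult]
  have h1 := abs_visitCount_sub_le hc hz s hM le_rfl hb0 hb1
  have h2 := abs_visitCount_sub_le hc hz 1 (by lia : 0 < N) le_rfl hb0 hb1
  rw [visitCount_orderedPts hirr, sub_zero] at h2
  rw [sub_zero] at h1
  have hlog : 6 * (1 + Real.log M / c) ≤ 6 * (1 + Real.log N / c) := by gcongr
  set E := 6 * (1 + Real.log N / c)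
  have h3 : |(i.val : ℝ) + 1 - N * b| ≤ E + 1 := by
    rw [abs_le] at h2 ⊢
    constructor <;> linarith
  have h4 : |(M : ℝ) / N * (i.val + 1 - N * b)| ≤ E + 1 := by
    rw [abs_mul, abs_of_nonneg (by positivity)]
    exact (mul_le_of_le_one_left (abs_nonneg _) ((div_le_one hN0).2 hMN')).trans h3
  calc |(visitCount z s M 0 b : ℝ) - M / N * (i.val + 1)|
      = |((visitCount z s M 0 b : ℝ) - M * b) - M / N * (i.val + 1 - N * b)| := by
        congr 1
        field_simp
        ring
    _ ≤ _ := abs_sub _ _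
    _ ≤ 2 * E + 1 := by linarith

/-! ### Star-discrepancy and conclusion -/

theorem starDiscrepancy_kronecker_le {z c : ℝ} (hc : 0 < c)
    (hz : ∀ r : ℚ, c / (r.den : ℝ) ^ 2 ≤ |z - r|) {N : ℕ} (hN : 0 < N) :
    starDiscrepancy (kronecker z) N ≤ 6 * (1 + Real.log N / c) / N := by
  have hN0 : (0 : ℝ) < N := by exact_mod_cast hN
  refine ciSup_le fun b => ?_
  have h := abs_visitCount_sub_le hc hz 1 hN le_rfl b.2.1 b.2.2
  have hIcc : Ico 1 (1 + N) = Icc 1 N := by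
    ext n
    simp only [mem_Ico, mem_Icc]
    lia
  rw [visitCount, hIcc, sub_zero] at h
  rw [le_div_iff₀ hN0]
  calc _ = |((#{n ∈ Icc 1 N | kronecker z n ∈ Set.Ico 0 (b : ℝ)} : ℝ) / N - b) * N| := by
        rw [abs_mul, abs_of_pos hN0]
    _ = _ := by rw [sub_mul, div_mul_cancel₀ _ hN0.ne', mul_comm (b : ℝ)]
    _ ≤ _ := h

/-- The constant `13` is absorbed by `26 log N`, as `log 2 > 1 / 2`. -/
theorem affine_log_le {c : ℝ} {N : ℕ} (hN : 2 ≤ N) :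
    2 * (6 * (1 + Real.log N / c)) + 1 ≤ (26 + 12 / c) * Real.log N := by
  have h1 : Real.log 2 ≤ Real.log N := Real.log_le_log (by norm_num) (by exact_mod_cast hN)
  have h2 := Real.log_two_gt_d9
  rw [add_mul, div_mul_eq_mul_div, mul_div_assoc]
  linarith

theorem isLowDiscrepancy_kronecker {z c : ℝ} (hc : 0 < c)
    (hz : ∀ r : ℚ, c / (r.den : ℝ) ^ 2 ≤ |z - r|) : IsLowDiscrepancy (kronecker z) := by
  refine Asymptotics.IsBigO.of_bound (26 + 12 / c) ?_
  filter_upwards [Filter.eventually_ge_atTop 2] with N hN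
  have hlog : 0 ≤ Real.log N := Real.log_natCast_nonneg N
  have hnn : 0 ≤ starDiscrepancy (kronecker z) N := Real.iSup_nonneg fun _ => abs_nonneg _
  rw [Real.norm_of_nonneg hnn, Real.norm_of_nonneg (by positivity)]
  refine (starDiscrepancy_kronecker_le hc hz (by lia)).trans ?_
  rw [← mul_div_assoc]
  have := affine_log_le (c := c) hN
  have : 0 ≤ Real.log N / c := by positivity
  refine div_le_div_of_nonneg_right ?_ (Nat.cast_nonneg N)
  linarith

theorem gapCondition_kronecker {z c : ℝ} (hirr : Irrational z) (hc : 0 < c)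
    (hz : ∀ r : ℚ, c / (r.den : ℝ) ^ 2 ≤ |z - r|) {N : ℕ} (hN : 2 ≤ N) :
    ∃ ρ : ℝ, ρ ≤ 26 + 12 / c ∧
      GapCondition (kronecker z) N ρ ((26 + 12 / c) * Real.log N) := by
  have hN0 : (0 : ℝ) < N := by exact_mod_cast (by lia : 0 < N)
  obtain ⟨i, -, hi⟩ := exists_max_image (univ : Finset (Fin N)) (gap (kronecker z) N)
    ⟨⟨0, by lia⟩, mem_univ _⟩
  have hdiv : (N * gap (kronecker z) N i - 2 + 2) / N = gap (kronecker z) N i := by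
    field_simp
    ring
  refine ⟨N * gap (kronecker z) N i - 2, ?_, ?_, ?_, orderedPts_eq_add_sum_gapCount _ N, ?_⟩
  · have := mul_gap_kronecker_le hirr hc hz hN i
    have : 2 / c ≤ 12 / c := by gcongr; norm_num
    linarith
  -- The largest of `N` gaps with sum `1` is at least their mean.
  · have hle : 1 ≤ N * gap (kronecker z) N i := by
      rw [← sum_gap (kronecker z) (by lia : 0 < N)]
      simpa using sum_le_card_nsmul univ (gap (kronecker z) N) _ fun k _ => hi k (mem_univ k)
    have hne : N * gap (kronecker z) N i ≠ 1 := by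
      have := ((irrational_gap_kronecker hirr hN i).natCast_mul (by lia : N ≠ 0)).ne_nat 1
      simpa using this
    have := lt_of_le_of_ne hle hne.symm
    linarith
  · rw [hdiv]
    refine ⟨mem_coe.2 (mem_image_of_mem _ (mem_univ i)), ?_⟩
    intro L hL
    obtain ⟨k, -, rfl⟩ := mem_image.1 (mem_coe.1 hL)
    exact hi k (mem_univ k)
  · intro k L hL
    exact (abs_gapCount_sub_le hirr hc hz hN k hL).trans (affine_log_le hN)

theorem mainTheorem8 (R : ℕ) :
    ∃ C : ℝ, 0 < C ∧ ∀ z : ℝ, Irrational z → PartialQuotientsLE z R →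
      FiniteGapProperty (kronecker z) 3 ∧
      (∀ N : ℕ, 2 ≤ N → ∃ ρ : ℝ, ρ ≤ C ∧
        GapCondition (kronecker z) N ρ (C * Real.log N)) ∧
      IsLowDiscrepancy (kronecker z) := by
  set c : ℝ := 1 / (R + 2) with hc
  have hc0 : 0 < c := by positivity
  refine ⟨26 + 12 / c, by positivity, fun z hirr hz => ?_⟩
  have hbad (r : ℚ) : c / (r.den : ℝ) ^ 2 ≤ |z - r| := by
    rw [hc, div_div]
    exact hz.le_abs_sub_rat hirr r
  exact ⟨finiteGapProperty_kronecker hirr, fun N hN => gapCondition_kronecker hirr hc0 hbad hN,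
    isLowDiscrepancy_kronecker hc0 hbad⟩
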